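/- For $n\ge 0$ let $c_8(n)$ denote the number of partitions of $n$ in which either (a) all parts are even and distinct (the empty partition of $0$ included), or (b) at least one part is odd and, writing the largest odd part as $2j-1$ with $j\ge 1$: every positive odd integer $i\le j$ appears as a part once or twice; every odd integer $i$ with $j<i\le 2j-1$ appears as a part exactly once; the even parts are distinct; and every even part greater than $j$ is at least $2j+2$. Then for all $n\ge 0$ and every $r\in\{6,20,27,34,41,48\}$, $$c_8(49n+r)\equiv 0 \pmod 2.$$ -/

import Mathlib

/-- First kind of partition counted by `c8`: all parts are even and distinct.
The empty partition of `0` is of this kind. -/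
def IsEvenDistinct {n : ℕ} (p : n.Partition) : Prop :=
  p.parts.Nodup ∧ ∀ i ∈ p.parts, Even i

/-- Second kind of partition counted by `c8`, with largest odd part `2 * j - 1`. -/
structure IsOddInitial {n : ℕ} (p : n.Partition) (j : ℕ) : Prop where
  one_le : 1 ≤ j
  /-- `2 * j - 1` is a part. -/
  mem : 2 * j - 1 ∈ p.parts
  /-- No odd part exceeds `2 * j - 1`. -/
  odd_le : ∀ i ∈ p.parts, Odd i → i ≤ 2 * j - 1
  /-- Every positive odd integer `≤ j` appears once or twice. -/
  odd_small : ∀ i ≤ j, Odd i → p.parts.count i = 1 ∨ p.parts.count i = 2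
  /-- Every odd integer `> j` (up to the largest odd part) appears exactly once. -/
  odd_large : ∀ i ≤ 2 * j - 1, j < i → Odd i → p.parts.count i = 1
  /-- Even parts are distinct. -/
  even_distinct : ∀ i ∈ p.parts, Even i → p.parts.count i = 1
  /-- Even parts `> j` are at least `2 * j + 2`. -/
  even_large : ∀ i ∈ p.parts, Even i → j < i → 2 * j + 2 ≤ i

/-- The number of partitions of `n` that are of the first kind, or of the second kind
for some `j`. -/
noncomputable def c8 (n : ℕ) : ℕ :=
  Nat.card {p : n.Partition // IsEvenDistinct p ∨ ∃ j : ℕ, IsOddInitial p j}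

/-! Write `(q)_n` for the product of `1 - q ^ i` over `1 ≤ i ≤ n`. Removing `1, 3, …, 2j - 1`, of
sum `j²`, leaves distinct parts that are `≤ j`, or even and `≥ 2j + 2`. As `1 + q ^ (2k) = (1 + q ^
k)²` mod 2, the generating function becomes `(q)_∞² ∑ q ^ (j²) / (q)_j`. The pentagonal number
theorem (`tailProd_zero_eq_sum`) expands one factor `(q)_∞`, and Rogers–Ramanujan
(`sum_sq_mul_tailProd`) the rest, as theta series with exponents `k(3k-1)/2` and `l(5l-1)/2`. If `c8
n` is odd, completing squares gives `120n + 8 = 5x² + 3y²`. This form is anisotropic mod 7, so it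
cannot represent a number divisible by 7 exactly once; the listed residues make `120n + 8` such a
number. -/

/-! ### Truncated q-series in characteristic two, with `q` nilpotent. -/

section TailProducts

open Finset

variable {A : Type*} [CommRing A]

/-- The product of `1 + q ^ k` over `i < k ≤ i + N`. When `q ^ N = 0` this is the
product over all `k > i`. -/
def tailProd (q : A) (N i : ℕ) : A := ∏ k ∈ range N, (1 + q ^ (i + k + 1))

variable {q : A} {N : ℕ}

theorem tailProd_of_le (hq : q ^ N = 0) {i : ℕ} (h : N ≤ i) : tailProd q N i = 1 :=
  prod_eq_one fun k _ => by rw [pow_eq_zero_of_le (by omega : N ≤ i + k + 1) hq, add_zero]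

theorem tailProd_succ (hq : q ^ N = 0) (i : ℕ) :
    tailProd q N i = (1 + q ^ (i + 1)) * tailProd q N (i + 1) := by
  have h := prod_range_succ' (fun k => 1 + q ^ (i + k + 1)) N
  rw [prod_range_succ, pow_eq_zero_of_le (by omega : N ≤ i + N + 1) hq, add_zero, mul_one] at h
  rw [tailProd, h, tailProd, mul_comm]
  congr 1
  exact prod_congr rfl fun k _ => by congr 2; ring

theorem isUnit_one_add_pow (hq : q ^ N = 0) (i : ℕ) : IsUnit (1 + q ^ (i + 1)) := by
  refine IsNilpotent.isUnit_one_add ⟨N, ?_⟩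
  rw [← pow_mul, mul_comm, pow_mul, hq, zero_pow (Nat.succ_ne_zero i)]

theorem prod_Icc_mul_tailProd (hq : q ^ N = 0) (j : ℕ) :
    (∏ i ∈ Icc 1 j, (1 + q ^ i)) * tailProd q N j = tailProd q N 0 := by
  induction j with
  | zero => simp
  | succ j ih => rw [prod_Icc_succ_top (by omega), mul_assoc, ← tailProd_succ hq, ih]

/-- The Durfee rectangle sum `∑ q ^ (i (i + s)) / ((q)_i (q)_{i+s})`, multiplied by `(q)_∞ ^ 2`. -/
def durfeeSum (q : A) (N s : ℕ) : A :=
  ∑ i ∈ range N, q ^ (i * i + s * i) * (tailProd q N i * tailProd q N (i + s))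

/-- The terms of the pentagonal number series, with the indices `r` and `-r` combined. -/
def pentagonalTerm (q : A) (r : ℕ) : A :=
  if r = 0 then 1 else q ^ (r + 3 * r.choose 2) * (1 + q ^ r)

section CharTwo

variable [CharP A 2]

/-- Splitting a factor off one tail product leaves either `q ^ (s + 1)` times a term of the next
sum, or `f i`, whose factor `1 + q ^ i` kills `i = 0` and permits an index shift. -/
theorem durfeeSum_add_durfeeSum_succ (hq : q ^ N = 0) (s : ℕ) :
    durfeeSum q N s + durfeeSum q N (s + 1) =
      q ^ (s + 1) * (durfeeSum q N (s + 1) + durfeeSum q N (s + 2)) := by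
  set f : ℕ → A := fun i =>
    q ^ (i * i + s * i) * (1 + q ^ i) * (tailProd q N i * tailProd q N (i + s + 1)) with hf
  have hsum : ∑ i ∈ range N, f i = q ^ (s + 1) * durfeeSum q N (s + 2) := by
    have hN : f N = 0 := by
      simp only [hf]
      rcases Nat.eq_zero_or_pos N with rfl | h
      · have : (1 : A) = 0 := by simpa using hq
        rw [← mul_one (_ * _), this, mul_zero]
      · rw [pow_eq_zero_of_le (by nlinarith : N ≤ N * N + s * N) hq]; simp
    have h0 : f 0 = 0 := by simp [hf, CharTwo.add_self_eq_zero]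
    have h := sum_range_succ f N
    rw [sum_range_succ', hN, h0, add_zero, add_zero] at h
    rw [← h, durfeeSum, mul_sum]
    refine sum_congr rfl fun i _ => ?_
    simp only [hf]
    rw [tailProd_succ hq i, show i + 1 + s + 1 = i + (s + 2) by ring]
    ring
  rw [mul_add, ← hsum]
  simp only [durfeeSum, mul_sum, ← sum_add_distrib]
  refine sum_congr rfl fun i _ => ?_
  simp only [hf]
  rw [tailProd_succ hq (i + s), show i + (s + 1) = i + s + 1 by ring]
  ring

/-- Descending induction on `s`: consecutive differences are multiples of the next ones, and vanish
once `s ≥ N`. -/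
theorem durfeeSum_succ (hq : q ^ N = 0) (s : ℕ) : durfeeSum q N s = durfeeSum q N (s + 1) := by
  suffices ∀ d s, N ≤ s + d → durfeeSum q N s = durfeeSum q N (s + 1) from this N s (by omega)
  intro d
  induction d with
  | zero =>
    intro s h
    have := durfeeSum_add_durfeeSum_succ hq s
    rw [pow_eq_zero_of_le (by omega : N ≤ s + 1) hq, zero_mul] at this
    exact CharTwo.add_eq_zero.mp this
  | succ d ih =>
    intro s h
    have := durfeeSum_add_durfeeSum_succ hq s
    rw [ih (s + 1) (by omega), CharTwo.add_self_eq_zero, mul_zero] at this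
    exact CharTwo.add_eq_zero.mp (by rw [← this, ih (s + 1) (by omega)])

theorem durfeeSum_eq (hq : q ^ N = 0) (s : ℕ) : durfeeSum q N s = tailProd q N 0 := by
  have hs : ∀ d, durfeeSum q N s = durfeeSum q N (s + d) := fun d => by
    induction d with
    | zero => rfl
    | succ d ih => rw [ih, durfeeSum_succ hq, add_assoc]
  rw [hs N, durfeeSum]
  rcases Nat.eq_zero_or_pos N with rfl | h
  · have : (1 : A) = 0 := by simpa using hq
    exact eq_of_zero_eq_one this.symm _ _
  rw [sum_eq_single 0]
  · simp [tailProd_of_le hq (by omega : N ≤ s + N)]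
  · intro i _ hi
    have : 1 ≤ i := Nat.one_le_iff_ne_zero.mpr hi
    rw [pow_eq_zero_of_le (by nlinarith : N ≤ i * i + (s + N) * i) hq, zero_mul]
  · intro h'
    exact absurd (mem_range.mpr h) h'

/-- Closed form for the partial sums of the recurrence in `n` behind `tailProd_zero_mul_tailProd`,
which needs `R = n`. -/
theorem pentagonal_telescope (hq : q ^ N = 0) {n R : ℕ} (hR : R ≤ n) :
    (1 + q ^ (n + 1)) * ∑ r ∈ range (R + 1),
        pentagonalTerm q r * (tailProd q N (n + 1 - r) * tailProd q N (n + 1 + r)) +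
      ∑ r ∈ range (R + 1), pentagonalTerm q r * (tailProd q N (n - r) * tailProd q N (n + r)) =
      q ^ (n + 1 + 3 * (R + 1).choose 2) * (tailProd q N (n - R) * tailProd q N (n + 1 + R)) := by
  have h2 : (2 : A) = 0 := CharTwo.two_eq_zero
  induction R with
  | zero =>
    simp only [pentagonalTerm, zero_add, sum_range_one, if_true, one_mul, Nat.sub_zero, add_zero]
    rw [tailProd_succ hq n]
    norm_num
    linear_combination (1 + q ^ (n + 1)) * (tailProd q N (n + 1)) ^ 2 * h2
  | succ R ih =>
    specialize ih (by omega)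
    obtain ⟨m, rfl⟩ := Nat.exists_eq_add_of_le hR
    rw [sum_range_succ, sum_range_succ _ (R + 1), mul_add, add_add_add_comm, ih]
    rw [show R + 1 + m - R = m + 1 by omega, show R + 1 + m + 1 - (R + 1) = m + 1 by omega,
      show R + 1 + m - (R + 1) = m by omega,
      show R + 1 + m + 1 + R = R + 1 + m + (R + 1) by ring,
      show R + 1 + m + 1 + (R + 1) = R + 1 + m + (R + 1) + 1 by ring,
      tailProd_succ hq (R + 1 + m + (R + 1)), tailProd_succ hq m,
      show (R + 1 + 1).choose 2 = R + 1 + (R + 1).choose 2 by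
        rw [Nat.choose_succ_succ' (R + 1) 1, Nat.choose_one_right]]
    simp only [pentagonalTerm, Nat.succ_ne_zero, if_false]
    generalize tailProd q N (m + 1) = a
    generalize tailProd q N (R + 1 + m + (R + 1) + 1) = b
    generalize (R + 1).choose 2 = c
    linear_combination q ^ (R + 1) * q ^ (3 * c) * a * b * (1 + q ^ (R + 1) + q ^ (m + 1) +
      q ^ (R + 1) * q ^ (m + 1) + q ^ (2 * (R + 1)) * q ^ (m + 1) +
      q ^ (2 * (R + 1)) * q ^ (2 * (m + 1))) * h2

/-- A Bailey pair: divided by `(q)_∞²`, it expands `1 / (q)_n` in the `1 / ((q)_{n-r} (q)_{n+r})`.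
-/
theorem tailProd_zero_mul_tailProd (hq : q ^ N = 0) (n : ℕ) :
    tailProd q N 0 * tailProd q N n = ∑ r ∈ range (n + 1),
      pentagonalTerm q r * (tailProd q N (n - r) * tailProd q N (n + r)) := by
  have h2 : (2 : A) = 0 := CharTwo.two_eq_zero
  induction n with
  | zero => simp [pentagonalTerm]
  | succ n ih =>
    apply (isUnit_one_add_pow hq n).mul_left_cancel
    have h := pentagonal_telescope hq (le_refl n)
    rw [← ih, tailProd_succ hq n, Nat.sub_self] at h
    rw [sum_range_succ, mul_add, Nat.sub_self]
    have hT := tailProd_succ hq (n + 1 + n)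
    rw [hT, show n + 1 + n + 1 = n + 1 + (n + 1) by ring] at h
    simp only [pentagonalTerm, Nat.succ_ne_zero, if_false] at h ⊢
    generalize tailProd q N (n + 1 + (n + 1)) = b at h ⊢
    generalize (n + 1).choose 2 = c at h ⊢
    linear_combination -h + ((1 + q ^ (n + 1)) * tailProd q N 0 * tailProd q N (n + 1) -
      q ^ (n + 1) * q ^ (3 * c) * tailProd q N 0 * b * (1 + q ^ (n + 1) + q ^ (2 * (n + 1)))) * h2

theorem tailProd_zero_eq_sum (hq : q ^ N = 0) (hN : 0 < N) :
    tailProd q N 0 = ∑ r ∈ range N, pentagonalTerm q r := by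
  -- With `n = 2N`, both tails at `n ± r` are `1` for `r < N`.
  have h := tailProd_zero_mul_tailProd hq (2 * N)
  rw [tailProd_of_le hq (by omega : N ≤ 2 * N), mul_one] at h
  rw [h]
  symm
  refine (sum_congr rfl fun r hr => ?_).trans
    (sum_subset (range_subset_range.mpr (by omega : N ≤ 2 * N + 1)) fun r _ hr => ?_)
  · have := mem_range.mp hr
    rw [tailProd_of_le hq (by omega : N ≤ 2 * N - r),
      tailProd_of_le hq (by omega : N ≤ 2 * N + r), mul_one, mul_one]
  · have := mem_range.not.mp hr
    rw [pentagonalTerm, if_neg (by omega),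
      pow_eq_zero_of_le (by omega : N ≤ r + 3 * r.choose 2) hq, zero_mul, zero_mul]

/-- The first Rogers–Ramanujan identity in characteristic two. -/
theorem sum_sq_mul_tailProd (hq : q ^ N = 0) :
    ∑ j ∈ range N, q ^ (j * j) * (tailProd q N 0 * tailProd q N j) =
      tailProd q N 0 * ∑ r ∈ range N, pentagonalTerm q r * q ^ (r * r) := by
  have key : ∀ r ∈ range N, ∑ j ∈ Ico r N, q ^ (j * j) *
      (pentagonalTerm q r * (tailProd q N (j - r) * tailProd q N (j + r))) =
      tailProd q N 0 * (pentagonalTerm q r * q ^ (r * r)) := fun r hr => by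
    -- Put `j = i + r`: then `j² = i² + 2ri + r²`, a Durfee sum with `s = 2r`.
    rw [← durfeeSum_eq hq (2 * r), durfeeSum, sum_mul, sum_Ico_eq_sum_range]
    refine (sum_congr rfl fun i _ => ?_).trans
      (sum_subset (range_subset_range.mpr (Nat.sub_le N r)) fun i _ hi => ?_)
    · rw [Nat.add_sub_cancel_left, show r + i + r = i + 2 * r by ring]
      ring
    · have := mem_range.not.mp hi
      have h1 : q ^ (i * i + 2 * r * i) * q ^ (r * r) = 0 := by
        rw [← pow_add]
        have hir : N ≤ i + r := by omega
        exact pow_eq_zero_of_le (by nlinarith [Nat.le_mul_self (i + r)]) hq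
      linear_combination tailProd q N i * tailProd q N (i + 2 * r) * pentagonalTerm q r * h1
  rw [mul_sum, ← sum_congr rfl key]
  simp only [tailProd_zero_mul_tailProd hq, mul_sum]
  refine sum_comm' fun j r => ?_
  simp only [mem_range, mem_Ico]
  omega

end CharTwo
end TailProducts

/-! ### Partitions as subsets of optional parts. -/

section Counting

open Finset

/-- The parts that can be removed from a partition counted by `c8` with largest odd part
`2 * j - 1` (no odd part, if `j = 0`), beyond one copy of each of `1, 3, …, 2 * j - 1`. -/
def optionalParts (j n : ℕ) : Finset ℕ :=
  {i ∈ Icc 1 n | i ≤ j ∨ Even i ∧ 2 * j + 2 ≤ i}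

/-- The first `j` odd numbers. -/
def oddsBelow (j : ℕ) : Finset ℕ := {i ∈ range (2 * j) | Odd i}

theorem sum_oddsBelow (j : ℕ) : ∑ i ∈ oddsBelow j, i = j * j := by
  induction j with
  | zero => rfl
  | succ j ih =>
    have h : oddsBelow (j + 1) = insert (2 * j + 1) (oddsBelow j) := by
      ext i
      simp only [oddsBelow, mem_filter, mem_range, mem_insert]
      grind
    rw [h, sum_insert (by simp [oddsBelow]), ih]
    ring

theorem count_val (s : Finset ℕ) (i : ℕ) : s.val.count i = if i ∈ s then 1 else 0 := by
  rw [Multiset.count_eq_of_nodup s.nodup]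
  simp

theorem mem_oddsBelow {i j : ℕ} : i ∈ oddsBelow j ↔ i < 2 * j ∧ Odd i := by
  simp [oddsBelow]

theorem mem_optionalParts {i j n : ℕ} :
    i ∈ optionalParts j n ↔ (1 ≤ i ∧ i ≤ n) ∧ (i ≤ j ∨ Even i ∧ 2 * j + 2 ≤ i) := by
  simp [optionalParts]

theorem isEvenDistinct_of_parts_eq {n : ℕ} {p : n.Partition} {s : Finset ℕ}
    (hs : s ⊆ optionalParts 0 n) (h : p.parts = s.val + (oddsBelow 0).val) :
    IsEvenDistinct p := by
  have h0 : p.parts = s.val := by rw [h]; simp [oddsBelow]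
  refine ⟨h0 ▸ s.nodup, fun i hi => ?_⟩
  rw [h0] at hi
  have := mem_optionalParts.mp (hs hi)
  grind

theorem isOddInitial_of_parts_eq {n j : ℕ} {p : n.Partition} {s : Finset ℕ} (hj : 1 ≤ j)
    (hs : s ⊆ optionalParts j n) (h : p.parts = s.val + (oddsBelow j).val) :
    IsOddInitial p j := by
  have hc : ∀ i, p.parts.count i = (if i ∈ s then 1 else 0) + if i ∈ oddsBelow j then 1 else 0 :=
    fun i => by rw [h, Multiset.count_add, count_val, count_val]
  have hmem : ∀ i, i ∈ p.parts ↔ i ∈ s ∨ i ∈ oddsBelow j := fun i => by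
    rw [h, Multiset.mem_add]; rfl
  have hs' : ∀ i ∈ s, (1 ≤ i ∧ i ≤ n) ∧ (i ≤ j ∨ Even i ∧ 2 * j + 2 ≤ i) :=
    fun i hi => mem_optionalParts.mp (hs hi)
  refine ⟨hj, ?_, ?_, ?_, ?_, ?_, ?_⟩
  · rw [hmem, mem_oddsBelow]
    exact Or.inr ⟨by omega, ⟨j - 1, by omega⟩⟩
  · intro i hi ho
    rw [hmem, mem_oddsBelow] at hi
    grind
  · intro i hi ho
    rw [hc, if_pos (mem_oddsBelow.mpr ⟨by omega, ho⟩)]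
    split_ifs <;> simp
  · intro i hi hji ho
    rw [hc, if_pos (mem_oddsBelow.mpr ⟨by omega, ho⟩), if_neg]
    intro his
    grind
  · intro i hi he
    rw [hmem, mem_oddsBelow] at hi
    rw [hc, if_pos (by grind), if_neg (by rw [mem_oddsBelow]; grind)]
  · intro i hi he hji
    rw [hmem, mem_oddsBelow] at hi
    grind

theorem parts_eq_of_count {n j : ℕ} {p : n.Partition}
    (h1 : ∀ i ∈ p.parts, i ∉ oddsBelow j → p.parts.count i = 1 ∧ i ∈ optionalParts j n)
    (h2 : ∀ i ∈ oddsBelow j, p.parts.count i = 1 ∨ p.parts.count i = 2 ∧ i ∈ optionalParts j n) :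
    ∃ s ⊆ optionalParts j n, p.parts = s.val + (oddsBelow j).val := by
  refine ⟨{i ∈ optionalParts j n |
    p.parts.count i = (if i ∈ oddsBelow j then 1 else 0) + 1}, filter_subset _ _, ?_⟩
  ext i
  simp only [Multiset.count_add, count_val, mem_filter]
  by_cases ho : i ∈ oddsBelow j
  · simp only [ho, if_true]
    rcases h2 i ho with h | h
    · simp [h]
    · simp [h]
  · simp only [ho, if_false]
    by_cases hi : i ∈ p.parts
    · simp [h1 i hi ho]
    · simp [Multiset.count_eq_zero_of_notMem hi]

theorem le_of_mem_parts {n : ℕ} {p : n.Partition} {i : ℕ} (hi : i ∈ p.parts) : i ≤ n :=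
  (Multiset.le_sum_of_mem hi).trans_eq p.parts_sum

theorem IsEvenDistinct.exists_parts_eq {n : ℕ} {p : n.Partition} (h : IsEvenDistinct p) :
    ∃ s ⊆ optionalParts 0 n, p.parts = s.val + (oddsBelow 0).val := by
  apply parts_eq_of_count
  · intro i hi _
    refine ⟨Multiset.count_eq_one_of_mem h.1 hi, mem_optionalParts.mpr ?_⟩
    have h1 := h.2 i hi
    have h2 := p.parts_pos hi
    have h3 := le_of_mem_parts hi
    grind
  · simp [oddsBelow]

theorem IsOddInitial.exists_parts_eq {n j : ℕ} {p : n.Partition} (h : IsOddInitial p j) :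
    ∃ s ⊆ optionalParts j n, p.parts = s.val + (oddsBelow j).val := by
  have hj := h.one_le
  apply parts_eq_of_count
  · intro i hi ho
    have h2 := p.parts_pos hi
    have h3 := le_of_mem_parts hi
    have h4 := h.odd_le i hi
    have h5 := h.even_distinct i hi
    have h6 := h.even_large i hi
    rw [mem_oddsBelow] at ho
    rw [mem_optionalParts]
    grind
  · intro i hi
    rw [mem_oddsBelow] at hi
    rcases le_or_gt i j with hij | hij
    · rcases h.odd_small i hij hi.2 with h1 | h1
      · exact Or.inl h1
      · have hm : i ∈ p.parts := Multiset.count_pos.mp (by omega)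
        exact Or.inr ⟨h1, mem_optionalParts.mpr
          ⟨⟨p.parts_pos hm, le_of_mem_parts hm⟩, Or.inl hij⟩⟩
    · exact Or.inl (h.odd_large i (by omega) hij hi.2)

/-- The odd optional parts are at most `j`, so no odd part on the left reaches `2 * k - 1` if `j <
k`. -/
theorem index_le_of_val_add_eq {n j k : ℕ} {s t : Finset ℕ} (hs : s ⊆ optionalParts j n)
    (h : s.val + (oddsBelow j).val = t.val + (oddsBelow k).val) : k ≤ j := by
  by_contra! hjk
  have hm : 2 * k - 1 ∈ t.val + (oddsBelow k).val :=
    Multiset.mem_add.mpr (Or.inr (mem_oddsBelow.mpr ⟨by omega, ⟨k - 1, by omega⟩⟩))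
  rw [← h, Multiset.mem_add] at hm
  rcases hm with hm | hm
  · have := mem_optionalParts.mp (hs hm)
    grind
  · have := mem_oddsBelow.mp hm
    omega

theorem c8_eq_sum (n : ℕ) :
    c8 n = ∑ j ∈ range (n + 1),
      #{s ∈ (optionalParts j n).powerset | ∑ i ∈ s, i + j * j = n} := by
  classical
  rw [c8, Nat.card_eq_fintype_card, Fintype.card_subtype, ← card_sigma]
  symm
  have hsum : ∀ x : Σ _ : ℕ, Finset ℕ, (x.2.val + (oddsBelow x.1).val).sum =
      ∑ i ∈ x.2, i + x.1 * x.1 := fun x => by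
    rw [Multiset.sum_add, sum_val, sum_val, ← sum_oddsBelow]; rfl
  have hx : ∀ x ∈ (range (n + 1)).sigma fun j =>
      {s ∈ (optionalParts j n).powerset | ∑ i ∈ s, i + j * j = n},
      x.2 ⊆ optionalParts x.1 n ∧ ∑ i ∈ x.2, i + x.1 * x.1 = n := fun x hx => by
    rw [mem_sigma, mem_filter, mem_powerset] at hx
    exact hx.2
  refine card_bij (fun x h => ⟨x.2.val + (oddsBelow x.1).val, ?_, ?_⟩) ?_ ?_ ?_
  · intro i hi
    rw [Multiset.mem_add] at hi
    rcases hi with hi | hi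
    · exact (mem_optionalParts.mp ((hx x h).1 hi)).1.1
    · exact (mem_oddsBelow.mp hi).2.pos
  · rw [hsum, (hx x h).2]
  · intro x h
    rw [mem_filter_univ]
    rcases Nat.eq_zero_or_pos x.1 with h0 | h0
    · left
      refine isEvenDistinct_of_parts_eq (s := x.2) (h0 ▸ (hx x h).1) ?_
      exact congrArg (fun k => x.2.val + (oddsBelow k).val) h0
    · exact Or.inr ⟨x.1, isOddInitial_of_parts_eq h0 (hx x h).1 rfl⟩
  · rintro ⟨j, s⟩ h ⟨k, t⟩ h' heq
    have heq : s.val + (oddsBelow j).val = t.val + (oddsBelow k).val :=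
      congrArg Nat.Partition.parts heq
    obtain rfl : j = k := le_antisymm (index_le_of_val_add_eq (hx _ h').1 heq.symm)
      (index_le_of_val_add_eq (hx _ h).1 heq)
    rw [val_inj.mp (add_right_cancel heq)]
  · intro p hp
    rw [mem_filter_univ] at hp
    obtain ⟨j, s, hs, h⟩ : ∃ j, ∃ s ⊆ optionalParts j n,
        p.parts = s.val + (oddsBelow j).val := by
      rcases hp with hp | ⟨j, hp⟩
      · exact ⟨0, hp.exists_parts_eq⟩
      · exact ⟨j, hp.exists_parts_eq⟩
    have hn : ∑ i ∈ s, i + j * j = n := by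
      rw [← hsum ⟨j, s⟩, ← p.parts_sum, h]
    refine ⟨⟨j, s⟩, ?_, Nat.Partition.ext h.symm⟩
    rw [mem_sigma, mem_filter, mem_powerset, mem_range]
    have hj : j < n + 1 := Nat.lt_succ_iff.mpr
      ((Nat.le_mul_self j).trans ((Nat.le_add_left _ _).trans hn.le))
    exact ⟨hj, hs, hn⟩

end Counting

/-! ### Parity of `c8` and the quadratic form. -/

section Congruence

open Finset PowerSeries

theorem c8_cast_eq_coeff (n : ℕ) :
    (c8 n : ZMod 2) = coeff n (∑ j ∈ range (n + 1),
      (X : (ZMod 2)⟦X⟧) ^ (j * j) * ∏ i ∈ optionalParts j n, (1 + X ^ i)) := by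
  rw [c8_eq_sum, Nat.cast_sum, map_sum]
  refine sum_congr rfl fun j _ => ?_
  rw [prod_one_add, mul_sum, map_sum, card_filter, Nat.cast_sum]
  refine sum_congr rfl fun s _ => ?_
  rw [prod_pow_eq_pow_sum, ← pow_add, coeff_X_pow, add_comm (j * j)]
  simp [eq_comm]

theorem prod_optionalParts {A : Type*} [CommRing A] [CharP A 2] {q : A} {n j : ℕ}
    (hq : q ^ (n + 1) = 0) (hj : j ≤ n) :
    ∏ i ∈ optionalParts j n, (1 + q ^ i) = tailProd q (n + 1) 0 * tailProd q (n + 1) j := by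
  have hsplit : optionalParts j n = Icc 1 j ∪ {i ∈ Icc 1 n | Even i ∧ 2 * j + 2 ≤ i} := by
    ext i
    rw [mem_union, mem_filter, mem_Icc, mem_Icc, mem_optionalParts]
    grind
  have hdisj : Disjoint (Icc 1 j) {i ∈ Icc 1 n | Even i ∧ 2 * j + 2 ≤ i} := by
    rw [disjoint_left]
    intro i hi hi'
    rw [mem_filter] at hi'
    rw [mem_Icc] at hi
    omega
  have heven : ∏ i ∈ Icc 1 n with Even i ∧ 2 * j + 2 ≤ i, (1 + q ^ i) =
      tailProd q (n + 1) j ^ 2 := by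
    have himg : ∏ i ∈ (range (n + 1)).image (fun k => 2 * (j + k + 1)), (1 + q ^ i) =
        tailProd q (n + 1) j ^ 2 := by
      rw [prod_image (fun a _ b _ h => by simpa using h), tailProd, ← prod_pow]
      refine prod_congr rfl fun k _ => ?_
      rw [CharTwo.add_sq, one_pow, ← pow_mul, mul_comm]
    rw [← himg]
    refine prod_subset (fun i hi => ?_) fun i hi hi' => ?_
    · rw [mem_filter, mem_Icc] at hi
      obtain ⟨⟨_, h1⟩, ⟨k, rfl⟩, h2⟩ := hi
      exact mem_image.mpr ⟨k - j - 1, mem_range.mpr (by omega), by omega⟩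
    · obtain ⟨k, _, rfl⟩ := mem_image.mp hi
      rw [mem_filter, mem_Icc] at hi'
      rw [pow_eq_zero_of_le (by_contra fun h => hi'
        ⟨by omega, even_two_mul _, by omega⟩ : n + 1 ≤ 2 * (j + k + 1)) hq, add_zero]
  rw [hsplit, prod_union hdisj, heven, ← prod_Icc_mul_tailProd hq j]
  ring

theorem map_pentagonalTerm {A B : Type*} [CommRing A] [CommRing B] (f : A →+* B) (q : A) (r : ℕ) :
    f (pentagonalTerm q r) = pentagonalTerm (f q) r := by
  simp only [pentagonalTerm]
  split_ifs <;> simp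

theorem c8_cast_eq_coeff_mul (n : ℕ) :
    (c8 n : ZMod 2) = coeff n ((∑ r ∈ range (n + 1), pentagonalTerm (X : (ZMod 2)⟦X⟧) r) *
      ∑ r ∈ range (n + 1), pentagonalTerm X r * X ^ (r * r)) := by
  -- Modulo `X ^ (n + 1)` the variable is nilpotent, and the coefficient at `n` survives.
  set I : Ideal (ZMod 2)⟦X⟧ := Ideal.span {X ^ (n + 1)}
  have : Nontrivial ((ZMod 2)⟦X⟧ ⧸ I) := by
    rw [Ideal.Quotient.nontrivial_iff, Ne, Ideal.span_singleton_eq_top]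
    intro h
    simpa using h.map (constantCoeff (R := ZMod 2))
  have : CharP ((ZMod 2)⟦X⟧ ⧸ I) 2 :=
    charP_of_injective_ringHom (algebraMap (ZMod 2) ((ZMod 2)⟦X⟧ ⧸ I)).injective 2
  have hq : (Ideal.Quotient.mk I X) ^ (n + 1) = 0 := by
    rw [← map_pow, Ideal.Quotient.eq_zero_iff_mem]
    exact Ideal.mem_span_singleton_self _
  have key : Ideal.Quotient.mk I (∑ j ∈ range (n + 1),
      (X : (ZMod 2)⟦X⟧) ^ (j * j) * ∏ i ∈ optionalParts j n, (1 + X ^ i)) =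
      Ideal.Quotient.mk I ((∑ r ∈ range (n + 1), pentagonalTerm (X : (ZMod 2)⟦X⟧) r) *
      ∑ r ∈ range (n + 1), pentagonalTerm X r * X ^ (r * r)) := by
    simp only [map_sum, map_mul, map_prod, map_add, map_one, map_pow, map_pentagonalTerm]
    rw [← tailProd_zero_eq_sum hq (Nat.succ_pos n), ← sum_sq_mul_tailProd hq]
    refine sum_congr rfl fun j hj => ?_
    rw [prod_optionalParts hq (Nat.lt_succ_iff.mp (mem_range.mp hj))]
  rw [Ideal.Quotient.eq, Ideal.mem_span_singleton, X_pow_dvd_iff] at key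
  rw [c8_cast_eq_coeff, ← sub_eq_zero, ← map_sub]
  exact key n (Nat.lt_succ_self n)

theorem two_mul_choose_two_add (r : ℕ) : 2 * (r.choose 2 : ℤ) + r = r * r := by
  induction r with
  | zero => simp
  | succ r ih =>
    rw [Nat.choose_succ_succ' r 1, Nat.choose_one_right]
    push_cast
    linarith

/-- Complete the square in `e = ((3 + 2c)r² ∓ r) / 2`. The pentagonal series is `c = 0`,
Rogers–Ramanujan `c = 1`. -/
theorem exists_sq_of_coeff_pentagonalTerm_mul_ne_zero {R : Type*} [CommRing R] {r c e : ℕ}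
    (h : coeff e (pentagonalTerm (X : R⟦X⟧) r * X ^ (c * (r * r))) ≠ 0) :
    ∃ x : ℤ, (24 + 16 * c) * (e : ℤ) + 1 = x ^ 2 := by
  have hC := two_mul_choose_two_add r
  simp only [pentagonalTerm] at h
  split_ifs at h with hr
  · subst hr
    refine ⟨1, ?_⟩
    have : e = 0 := by
      by_contra he
      simp [coeff_one, he] at h
    simp [this]
  · rw [mul_add, mul_one, ← pow_add, add_mul, ← pow_add, ← pow_add, map_add, coeff_X_pow,
      coeff_X_pow] at h
    by_cases h1 : e = r + 3 * r.choose 2 + c * (r * r)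
    · refine ⟨(6 + 4 * c) * r - 1, ?_⟩
      rw [h1]
      push_cast
      linear_combination (36 + 24 * (c : ℤ)) * hC
    · rw [if_neg h1, zero_add] at h
      have h2 : e = r + 3 * r.choose 2 + r + c * (r * r) := by
        by_contra h2
        exact h (if_neg h2)
      refine ⟨(6 + 4 * c) * r + 1, ?_⟩
      rw [h2]
      push_cast
      linear_combination (36 + 24 * (c : ℤ)) * hC

/-- Holds because `-3/5 = 5` is not a square mod 7. -/
theorem seven_dvd_of_seven_dvd_form {x y : ℤ} (h : (7 : ℤ) ∣ 5 * x ^ 2 + 3 * y ^ 2) :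
    (7 : ℤ) ∣ x ∧ (7 : ℤ) ∣ y := by
  have key : ∀ a b : ZMod 7, 5 * a ^ 2 + 3 * b ^ 2 = 0 → a = 0 ∧ b = 0 := by decide
  have h' := (ZMod.intCast_zmod_eq_zero_iff_dvd _ 7).mpr h
  push_cast at h'
  have := key _ _ h'
  exact ⟨(ZMod.intCast_zmod_eq_zero_iff_dvd x 7).mp this.1,
    (ZMod.intCast_zmod_eq_zero_iff_dvd y 7).mp this.2⟩

theorem c8_cast_eq_zero_of_no_representation {n : ℕ}
    (h : ∀ x y : ℤ, 120 * (n : ℤ) + 8 ≠ 5 * x ^ 2 + 3 * y ^ 2) : (c8 n : ZMod 2) = 0 := by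
  rw [c8_cast_eq_coeff_mul, coeff_mul]
  refine sum_eq_zero fun p hp => ?_
  by_contra hne
  have h1 := left_ne_zero_of_mul hne
  have h2 := right_ne_zero_of_mul hne
  rw [map_sum] at h1 h2
  obtain ⟨r, _, h1⟩ := exists_ne_zero_of_sum_ne_zero h1
  obtain ⟨s, _, h2⟩ := exists_ne_zero_of_sum_ne_zero h2
  obtain ⟨x, hx⟩ := exists_sq_of_coeff_pentagonalTerm_mul_ne_zero (c := 0) (by simpa using h1)
  obtain ⟨y, hy⟩ := exists_sq_of_coeff_pentagonalTerm_mul_ne_zero (c := 1) (by simpa using h2)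
  have hn : (p.1 : ℤ) + p.2 = n := by exact_mod_cast mem_antidiagonal.mp hp
  apply h x y
  push_cast at hx hy
  linarith

end Congruence

theorem theorem9 (n r : ℕ) (hr : r ∈ ({6, 20, 27, 34, 41, 48} : Set ℕ)) :
    c8 (49 * n + r) ≡ 0 [MOD 2] := by
  rw [← ZMod.natCast_eq_natCast_iff, Nat.cast_zero]
  apply c8_cast_eq_zero_of_no_representation
  intro x y h
  push_cast at h
  simp only [Set.mem_insert_iff, Set.mem_singleton_iff] at hr
  -- Every listed `r` is `6` mod 7, so 7 divides `120r + 8`; 49 does so only for the omitted `r =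
  -- 13`.
  obtain ⟨⟨a, rfl⟩, b, rfl⟩ := seven_dvd_of_seven_dvd_form (x := x) (y := y) (by
    rw [← h]
    omega)
  ring_nf at h
  generalize a ^ 2 = u at h
  generalize b ^ 2 = v at h
  omega
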